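/- Let $V$ be a unital and integral quantale: a complete lattice with an associative (not necessarily commutative) tensor product $\otimes$ which distributes over arbitrary joins in each variable and whose unit is $k=\top\neq\bot$. A $V$-category is a set $X$ with a map $X\times X\to V$, $(x,x')\mapsto X(x,x')$, such that $k\le X(x,x)$ and $X(x,x')\otimes X(x',x'')\le X(x,x'')$ for all $x,x',x''\in X$; a $V$-functor $f\colon X\to Y$ is a map with $X(x,x')\le Y(f(x),f(x'))$ for all $x,x'\in X$. Let $V\text{-}\mathrm{Cat}$ be the category of $V$-categories and $V$-functors. Let $V\text{-}\mathrm{Cat}_{\mathrm{sym}}$ be its full subcategory of symmetric $V$-categories (those with $X(x,x')=X(x',x)$ for all $x,x'$), and let $V_\wedge\text{-}\mathrm{Cat}_{\mathrm{sym}}$ be its full subcategory of those symmetric $V$-categories which satisfy $X(x,x')\wedge X(x',x'')\le X(x,x'')$ for all $x,x',x''$. The quantale $V$ is called cartesian if $\otimes=\wedge$. A Mal'tsev category is a finitely complete category in which every relation is difunctional, that is: for every jointly monic span $X\xleftarrow{r_1}R\xrightarrow{r_2}Z$, every object $Y$ and all morphisms $x_1,x_2\colon Y\to X$ and $z_1,z_2\colon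 Y\to Z$, if the pairs $(x_1,z_2)$, $(x_2,z_2)$ and $(x_2,z_1)$ factor through $(r_1,r_2)$, then so does $(x_1,z_1)$. (Equivalently, it is a finitely complete category in which every reflexive relation is an equivalence relation.) 1. If $V$ is cartesian, then $(V\text{-}\mathrm{Cat}_{\mathrm{sym}})^{\mathrm{op}}$ is a Mal'tsev category. 2. For every unital and integral quantale $V$, the full subcategory $(V_\wedge\text{-}\mathrm{Cat}_{\mathrm{sym}})^{\mathrm{op}}$ of $(V\text{-}\mathrm{Cat})^{\mathrm{op}}$ is the largest full subcategory of $(V\text{-}\mathrm{Cat})^{\mathrm{op}}$ which is a Mal'tsev category and is closed in $(V\text{-}\mathrm{Cat})^{\mathrm{op}}$ under binary coproducts and under regular epimorphisms (if $P\to Q$ is a regular epimorphism in $(V\text{-}\mathrm{Cat})^{\mathrm{op}}$ and $P$ belongs to the subcategory, then so does $Q$). That is, it has these properties, and it contains every full subcategory which has them. -/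

import Mathlib

open CategoryTheory CategoryTheory.Limits

universe u v

/-! ### Relations and Mal'tsev categories -/

namespace MaltsevDual

section Relations

variable {C : Type u} [Category.{v} C]

/-- The pair of generalised elements `x : A ⟶ X`, `z : A ⟶ Z` belongs to the span `(r₁, r₂)`:
it factors through it. -/
def GenMem {A R X Z : C} (x : A ⟶ X) (z : A ⟶ Z) (r₁ : R ⟶ X) (r₂ : R ⟶ Z) : Prop :=
  ∃ t : A ⟶ R, t ≫ r₁ = x ∧ t ≫ r₂ = z

/-- A span is difunctional if, for every object `Y`, the relation which it induces between the
sets `C(Y, X)` and `C(Y, Z)` is difunctional. -/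
def IsDifunctional {R X Z : C} (r₁ : R ⟶ X) (r₂ : R ⟶ Z) : Prop :=
  ∀ (Y : C) (x₁ x₂ : Y ⟶ X) (z₁ z₂ : Y ⟶ Z),
    GenMem x₁ z₂ r₁ r₂ → GenMem x₂ z₂ r₁ r₂ → GenMem x₂ z₁ r₁ r₂ → GenMem x₁ z₁ r₁ r₂

end Relations

/-- A Mal'tsev category: a finitely complete category in which every relation (that is, every
jointly monic span) is difunctional. -/
structure IsMaltsevCategory (C : Type u) [Category.{v} C] : Prop where
  hasFiniteLimits : HasFiniteLimits C
  isDifunctional : ∀ {R X Z : C} (r₁ : R ⟶ X) (r₂ : R ⟶ Z),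
    JointlyMono₂ r₁ r₂ → IsDifunctional r₁ r₂

/-- The definition agrees with the other usual one: a finitely complete category is a Mal'tsev
category if and only if every reflexive relation in it is an equivalence relation. -/
theorem isMaltsevCategory_iff_reflexive (C : Type u) [Category.{v} C] :
    IsMaltsevCategory C ↔ HasFiniteLimits C ∧ ∀ {R X : C} (r₁ r₂ : R ⟶ X),
      ReflexiveRelation r₁ r₂ → IsEquivalenceRelation r₁ r₂ := by
  constructor
  · rintro ⟨hC, h⟩
    refine ⟨hC, fun {R X} r₁ r₂ e => ?_⟩
    have hd := h r₁ r₂ e.toJointlyMono₂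
    have hrefl : ∀ {A : C} (x : A ⟶ X), GenMem x x r₁ r₂ := fun x =>
      ⟨x ≫ e.r, by simp, by simp⟩
    obtain ⟨s, hs₁, hs₂⟩ := hd R r₂ r₁ r₁ r₂ (hrefl _) ⟨𝟙 _, by simp, by simp⟩ (hrefl _)
    obtain ⟨t, ht₁, ht₂⟩ := hd (pullback r₂ r₁) (pullback.fst r₂ r₁ ≫ r₁)
      (pullback.fst r₂ r₁ ≫ r₂) (pullback.snd r₂ r₁ ≫ r₂) (pullback.fst r₂ r₁ ≫ r₂)
      ⟨_, rfl, rfl⟩ (hrefl _) ⟨pullback.snd r₂ r₁, pullback.condition.symm, rfl⟩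
    exact ⟨⟨{ e with
      s := s
      symmetry₁ := hs₁
      symmetry₂ := hs₂
      c := _
      isLimit := pullback.isLimit r₂ r₁
      t := t
      transitivity₁ := ht₁
      transitivity₂ := ht₂ }⟩⟩
  · rintro ⟨hC, h⟩
    refine ⟨hC, fun {R X Z} r₁ r₂ hr Y x₁ x₂ z₁ z₂ => ?_⟩
    rintro ⟨a, ha₁, ha₂⟩ ⟨b, hb₁, hb₂⟩ ⟨c, hc₁, hc₂⟩
    -- the relation on `R` relating `d` and `d'` when `(r₁ d, r₂ d')` belongs to `R`
    let f : R ⨯ R ⟶ X ⨯ Z := prod.lift (prod.fst ≫ r₁) (prod.snd ≫ r₂)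
    let g : R ⟶ X ⨯ Z := prod.lift r₁ r₂
    have hf₁ : f ≫ prod.fst = prod.fst ≫ r₁ := prod.lift_fst _ _
    have hf₂ : f ≫ prod.snd = prod.snd ≫ r₂ := prod.lift_snd _ _
    have hg₁ : g ≫ prod.fst = r₁ := prod.lift_fst _ _
    have hg₂ : g ≫ prod.snd = r₂ := prod.lift_snd _ _
    clear_value f g
    let p₁ : pullback f g ⟶ R := pullback.fst f g ≫ prod.fst
    let p₂ : pullback f g ⟶ R := pullback.fst f g ≫ prod.snd
    have hg : ∀ {A : C} (k l : A ⟶ R), k ≫ g = l ≫ g → k = l := by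
      intro A k l hkl
      apply hr.right_cancellation
      · rw [← hg₁, reassoc_of% hkl]
      · rw [← hg₂, reassoc_of% hkl]
    have hmem : ∀ {A : C} (d d' k : A ⟶ R), k ≫ r₁ = d ≫ r₁ → k ≫ r₂ = d' ≫ r₂ →
        GenMem d d' p₁ p₂ := by
      intro A d d' k h₁ h₂
      refine ⟨pullback.lift (prod.lift d d') k ?_, ?_, ?_⟩
      · apply Limits.prod.hom_ext
        · rw [Category.assoc, hf₁, ← Category.assoc, prod.lift_fst, Category.assoc, hg₁, h₁]
        · rw [Category.assoc, hf₂, ← Category.assoc, prod.lift_snd, Category.assoc, hg₂, h₂]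
      · rw [← Category.assoc, pullback.lift_fst, prod.lift_fst]
      · rw [← Category.assoc, pullback.lift_fst, prod.lift_snd]
    have hmono : JointlyMono₂ p₁ p₂ := by
      refine ⟨fun A k l h₁ h₂ => ?_⟩
      have h₃ : k ≫ pullback.fst f g = l ≫ pullback.fst f g := by
        ext
        · simpa [p₁] using h₁
        · simpa [p₂] using h₂
      apply pullback.hom_ext h₃
      apply hg
      rw [Category.assoc, Category.assoc, ← pullback.condition, reassoc_of% h₃]
    have hrefl := hmem (𝟙 R) (𝟙 R) (𝟙 R) rfl rfl
    obtain ⟨⟨e⟩⟩ := h p₁ p₂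
      { toJointlyMono₂ := hmono
        r := hrefl.choose
        reflexivity₁ := hrefl.choose_spec.1
        reflexivity₂ := hrefl.choose_spec.2 }
    obtain ⟨m, hm₁, hm₂⟩ := hmem a b a rfl (by rw [ha₂, hb₂])
    obtain ⟨n, hn₁, hn₂⟩ := hmem b c c (by rw [hb₁, hc₁]) rfl
    let q : Y ⟶ e.c.pt := PullbackCone.IsLimit.lift e.isLimit m n (by rw [hm₂, hn₁])
    have hq₁ : (q ≫ e.t) ≫ p₁ = a := by
      rw [Category.assoc, e.transitivity₁, ← Category.assoc]
      simp [q, hm₁]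
    have hq₂ : (q ≫ e.t) ≫ p₂ = c := by
      rw [Category.assoc, e.transitivity₂, ← Category.assoc]
      simp [q, hn₂]
    refine ⟨(q ≫ e.t) ≫ pullback.snd f g, ?_, ?_⟩
    · have h₁ : pullback.snd f g ≫ r₁ = p₁ ≫ r₁ := by
        rw [Category.assoc, ← hf₁, pullback.condition_assoc, hg₁]
      rw [Category.assoc, h₁, ← Category.assoc, hq₁, ha₁]
    · have h₂ : pullback.snd f g ≫ r₂ = p₂ ≫ r₂ := by
        rw [Category.assoc, ← hf₂, pullback.condition_assoc, hg₂]
      rw [Category.assoc, h₂, ← Category.assoc, hq₂, hc₂]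

/-- A class of objects (a full subcategory) of `C` closed under regular epimorphisms: every
regular quotient in `C` of an object of the class belongs to the class. -/
def IsClosedUnderRegularEpi {C : Type u} [Category.{v} C] (P : ObjectProperty C) : Prop :=
  ∀ ⦃X Y : C⦄ (f : X ⟶ Y), IsRegularEpi f → P X → P Y

/-- The full subcategory of `C` on `P` is a Mal'tsev category in its own right, and it is closed
under binary coproducts and under regular epimorphisms in `C`. -/
structure IsClosedMaltsevSubcategory {C : Type u} [Category.{v} C] (P : ObjectProperty C) :
    Prop where
  isMaltsevCategory : IsMaltsevCategory P.FullSubcategory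
  closedUnderBinaryCoproducts : P.IsClosedUnderColimitsOfShape (Discrete WalkingPair)
  closedUnderRegularEpi : IsClosedUnderRegularEpi P

/-! ### Categories enriched in a quantale -/

/-- A quantale is cartesian if its tensor product is the binary meet. -/
def IsCartesian (V : Type v) [Monoid V] [CompleteLattice V] : Prop :=
  ∀ a b : V, a * b = a ⊓ b

/-- A (small) `V`-category: a set `X` with a map `X × X → V` satisfying (R) and (T). -/
structure VCat (V : Type v) [Monoid V] [CompleteLattice V] where
  carrier : Type u
  hom : carrier → carrier → V
  one_le_hom : ∀ x, 1 ≤ hom x x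
  hom_mul_hom_le : ∀ x y z, hom x y * hom y z ≤ hom x z

namespace VCat

variable {V : Type v} [Monoid V] [CompleteLattice V]

/-- A `V`-functor. -/
@[ext]
structure Functor (X Y : VCat.{u} V) where
  toFun : X.carrier → Y.carrier
  hom_le : ∀ x y, X.hom x y ≤ Y.hom (toFun x) (toFun y)

/-- The category `V-Cat` of `V`-categories and `V`-functors. -/
instance : Category (VCat.{u} V) where
  Hom X Y := Functor X Y
  id X := ⟨fun x => x, fun _ _ => le_rfl⟩
  comp f g := ⟨fun x => g.toFun (f.toFun x), fun x y => (f.hom_le x y).trans (g.hom_le _ _)⟩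

variable (V)

/-- Symmetric `V`-categories. -/
def symmetric : ObjectProperty (VCat.{u} V) := fun X =>
  ∀ x y, X.hom x y = X.hom y x

/-- `V_∧`-categories: the `V`-categories which are transitive with respect to the meet. -/
def wedge : ObjectProperty (VCat.{u} V) := fun X =>
  ∀ x y z, X.hom x y ⊓ X.hom y z ≤ X.hom x z

/-- Symmetric `V_∧`-categories. -/
def wedgeSymmetric : ObjectProperty (VCat.{u} V) := fun X =>
  wedge V X ∧ symmetric V X

end VCat

end MaltsevDual

/-!
Everything takes place in `V-Cat`, with limits and colimits interchanged.

The symmetric `V_∧`-categories are the sets with a symmetric structure map which is `⊤` on the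
diagonal and transitive for the meet; transitivity for the tensor product follows, because
`a ⊗ b ≤ a ∧ b` when the unit is the top element. Such structure maps are closed under meets and
under pulling back along maps of sets. Hence a colimit of underlying sets with the final structure
is a colimit (`hasColimitsOfShape_wedgeSymmetric`), and a limit in `V-Cat`, which carries the
initial structure, stays in the subcategory (`wedgeSymmetric_of_isColimit_op`). The latter gives
closure under products and under regular monomorphisms.

A jointly epic cospan `r₁, r₂` of symmetric `V_∧`-categories is jointly surjective, as maps into an
indiscrete object on the truth values show. Given maps out of its vertex `R` which extend
`(x₁, z₂)`, `(x₂, z₂)` and `(x₂, z₁)`, the pair `(x₁, z₁)` extends as a map of sets. It does so as a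
`V`-functor because the value of `R` at `(r₁ x, r₂ z)` is below the values of the target at
`(x₁ x, z₂ z)`, `(x₂ x, z₂ z)` and `(x₂ x, z₁ z)`, hence by symmetry and transitivity for the meet
below its value at `(x₁ x, z₁ z)` (`isMaltsevCategory_wedgeSymmetric_op`). If the tensor product is
the meet, every symmetric `V`-category is of this kind.

Conversely, embeddings are equalizers in `V-Cat`, so that a closed Mal'tsev subcategory which
contains `X` contains the two-point subspaces of `X` and of `X × X`, and the one-point space. The two
points of a two-point space form a jointly epic cospan; difunctionality of it, for maps into `X`
(`le_hom_of_isMaltsevCategory`), yields the symmetry of `X` from `{x, y} ⊆ X`, and its transitivity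
for the meet from `{(x, y), (y, z)} ⊆ X × X`, whose two points have distance `X(x, y) ∧ X(y, z)`.
-/

/-! ### Mal'tsev categories and equivalences -/

namespace MaltsevDual

theorem IsMaltsevCategory.of_equivalence {C : Type*} [Category* C] {D : Type*} [Category* D]
    (e : C ≌ D) (h : IsMaltsevCategory C) : IsMaltsevCategory D where
  hasFiniteLimits :=
    have := h.hasFiniteLimits
    ⟨fun _ _ _ => Adjunction.hasLimitsOfShape_of_equivalence e.inverse⟩
  isDifunctional {R X Z} r₁ r₂ hr Y x₁ x₂ z₁ z₂ h₁ h₂ h₃ := by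
    have hmono : JointlyMono₂ (e.inverse.map r₁) (e.inverse.map r₂) := by
      refine ⟨fun A f g h₁ h₂ => ?_⟩
      apply (e.toAdjunction.homEquiv _ _).symm.injective
      apply hr.right_cancellation
      · rw [← Adjunction.homEquiv_naturality_right_symm, h₁,
          Adjunction.homEquiv_naturality_right_symm]
      · rw [← Adjunction.homEquiv_naturality_right_symm, h₂,
          Adjunction.homEquiv_naturality_right_symm]
    have hmap : ∀ {x : Y ⟶ X} {z : Y ⟶ Z}, GenMem x z r₁ r₂ →
        GenMem (e.inverse.map x) (e.inverse.map z) (e.inverse.map r₁) (e.inverse.map r₂) := by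
      rintro _ _ ⟨t, rfl, rfl⟩
      exact ⟨e.inverse.map t, by simp, by simp⟩
    obtain ⟨t, ht₁, ht₂⟩ := h.isDifunctional _ _ hmono _ _ _ _ _ (hmap h₁) (hmap h₂) (hmap h₃)
    refine ⟨e.inverse.preimage t, ?_, ?_⟩ <;> apply e.inverse.map_injective <;> simpa

namespace VCat

/-! ### Ultrametric structure maps -/

section Ultrametric

variable {V : Type*} [CompleteLattice V]

/-- The structure maps of the symmetric `V_∧`-categories with underlying set `T`, over an
integral quantale `V`. -/
structure IsUltrametric {T : Type*} (h : T → T → V) : Prop where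
  refl : ∀ x, h x x = ⊤
  symm : ∀ x y, h x y = h y x
  trans : ∀ x y z, h x y ⊓ h y z ≤ h x z

theorem IsUltrametric.comp {S T : Type*} {h : T → T → V} (hh : IsUltrametric h) (f : S → T) :
    IsUltrametric fun x y => h (f x) (f y) where
  refl _ := hh.refl _
  symm _ _ := hh.symm _ _
  trans _ _ _ := hh.trans _ _ _

theorem IsUltrametric.iInf {ι : Sort*} {T : Type*} {h : ι → T → T → V}
    (hh : ∀ i, IsUltrametric (h i)) : IsUltrametric fun x y => ⨅ i, h i x y where
  refl x := by simp [(hh _).refl]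
  symm x y := iInf_congr fun i => (hh i).symm x y
  trans x y z := le_iInf fun i =>
    (inf_le_inf (iInf_le _ i) (iInf_le _ i)).trans ((hh i).trans x y z)

end Ultrametric

variable {V : Type v} [Monoid V] [CompleteLattice V]

/-! ### Morphisms of `V-Cat` -/

/-- The underlying map of a morphism of `V-Cat`. -/
def app {X Y : VCat.{u} V} (f : X ⟶ Y) : X.carrier → Y.carrier :=
  Functor.toFun f

/-- A `V`-functor as a morphism of `V-Cat`. -/
def mkHom {X Y : VCat.{u} V} (f : X.carrier → Y.carrier)
    (hf : ∀ x y, X.hom x y ≤ Y.hom (f x) (f y)) : X ⟶ Y :=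
  Functor.mk f hf

theorem hom_le_hom_app {X Y : VCat.{u} V} (f : X ⟶ Y) (x y : X.carrier) :
    X.hom x y ≤ Y.hom (app f x) (app f y) :=
  Functor.hom_le f x y

@[simp]
theorem app_mkHom {X Y : VCat.{u} V} (f : X.carrier → Y.carrier)
    (hf : ∀ x y, X.hom x y ≤ Y.hom (f x) (f y)) : app (mkHom f hf) = f :=
  rfl

@[simp]
theorem app_id (X : VCat.{u} V) (x : X.carrier) : app (𝟙 X) x = x :=
  rfl

@[simp]
theorem app_comp {X Y Z : VCat.{u} V} (f : X ⟶ Y) (g : Y ⟶ Z) (x : X.carrier) :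
    app (f ≫ g) x = app g (app f x) :=
  rfl

theorem hom_ext_app {X Y : VCat.{u} V} {f g : X ⟶ Y} (h : ∀ x, app f x = app g x) : f = g :=
  Functor.ext (funext h)

theorem app_unop_congr {X Y : (VCat.{u} V)ᵒᵖ} {f g : X ⟶ Y} (h : f = g) (y : Y.unop.carrier) :
    app f.unop y = app g.unop y := by
  rw [h]

/-- The forgetful functor from `V-Cat` to sets. -/
def forgetToType : VCat.{u} V ⥤ Type u where
  obj X := X.carrier
  map f := TypeCat.ofHom (app f)

/-! ### The tensor product of an integral quantale -/

theorem mul_le_inf [IsQuantale V] (one_eq_top : (1 : V) = ⊤) (a b : V) : a * b ≤ a ⊓ b := by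
  refine le_inf ?_ ?_
  · calc a * b ≤ a * 1 := mul_le_mul_right (one_eq_top ▸ le_top) a
      _ = a := mul_one a
  · calc a * b ≤ 1 * b := mul_le_mul_left (one_eq_top ▸ le_top) b
      _ = b := one_mul b

/-! ### Finite colimits of symmetric `V_∧`-categories -/

/-- The symmetric `V_∧`-category with a given structure map. -/
def ofUltrametric [IsQuantale V] (one_eq_top : (1 : V) = ⊤) {T : Type u} (h : T → T → V)
    (hh : IsUltrametric h) : (wedgeSymmetric.{u} V).FullSubcategory where
  obj :=
    { carrier := T
      hom := h
      one_le_hom x := by rw [hh.refl]; exact le_top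
      hom_mul_hom_le x y z := (mul_le_inf one_eq_top _ _).trans (hh.trans x y z) }
  property := ⟨hh.trans, hh.symm⟩

theorem hom_self (one_eq_top : (1 : V) = ⊤) (X : VCat.{u} V) (x : X.carrier) :
    X.hom x x = ⊤ :=
  top_le_iff.1 (one_eq_top ▸ X.one_le_hom x)

theorem isUltrametric_hom (one_eq_top : (1 : V) = ⊤)
    (X : (wedgeSymmetric.{u} V).FullSubcategory) : IsUltrametric X.obj.hom where
  refl := hom_self one_eq_top X.obj
  symm := X.property.2
  trans := X.property.1

/-- The colimit of the underlying sets carries the final structure: the meet of all structure maps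
of symmetric `V_∧`-categories for which the maps of the colimit cocone are `V`-functors. -/
theorem hasColimitsOfShape_wedgeSymmetric [IsQuantale V] (one_eq_top : (1 : V) = ⊤)
    (J : Type*) [Category* J] [HasColimitsOfShape J (Type u)] :
    HasColimitsOfShape J (wedgeSymmetric.{u} V).FullSubcategory := by
  refine ⟨fun F => ?_⟩
  let U := (wedgeSymmetric.{u} V).ι ⋙ forgetToType
  let G : J ⥤ Type u := F ⋙ U
  let ι (j : J) (x : (F.obj j).obj.carrier) : colimit G := colimit.ι G j x
  let admissible (h : colimit G → colimit G → V) : Prop :=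
    IsUltrametric h ∧ ∀ j x y, (F.obj j).obj.hom x y ≤ h (ι j x) (ι j y)
  let L : (wedgeSymmetric.{u} V).FullSubcategory := ofUltrametric one_eq_top
    (fun x y => ⨅ h : {h // admissible h}, h.1 x y) (IsUltrametric.iInf fun h => h.2.1)
  let c : Cocone F :=
    { pt := L
      ι :=
        { app j := ObjectProperty.homMk (mkHom (ι j) fun x y => le_iInf fun h => h.2.2 j x y)
          naturality i j f := by
            ext1
            apply hom_ext_app
            intro x
            exact ConcreteCategory.congr_hom (colimit.w G f) x } }
  refine ⟨⟨⟨c, ?_⟩⟩⟩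
  let d (s : Cocone F) : colimit G ⟶ s.pt.obj.carrier := colimit.desc G (U.mapCocone s)
  have hd (s : Cocone F) (j : J) (x : (F.obj j).obj.carrier) :
      d s (ι j x) = app (s.ι.app j).hom x :=
    ConcreteCategory.congr_hom (colimit.ι_desc (U.mapCocone s) j) x
  have hs (s : Cocone F) : admissible fun x y => s.pt.obj.hom (d s x) (d s y) := by
    refine ⟨(isUltrametric_hom one_eq_top s.pt).comp _, fun j x y => ?_⟩
    simp only [hd]
    exact hom_le_hom_app _ x y
  exact
    { desc s := ObjectProperty.homMk (mkHom (d s) fun x y => iInf_le_of_le ⟨_, hs s⟩ le_rfl)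
      fac s j := by
        ext1
        exact hom_ext_app (hd s j)
      uniq s m hm := by
        ext1
        apply hom_ext_app
        have : TypeCat.ofHom (app m.hom) = d s := by
          apply colimit.hom_ext
          intro j
          ext x
          refine Eq.trans ?_ (hd s j x).symm
          rw [← hm j]
          rfl
        exact fun x => ConcreteCategory.congr_hom this x }

/-! ### The Mal'tsev property -/

/-- The indiscrete `V`-category on the truth values. -/
def indiscrete [IsQuantale V] (one_eq_top : (1 : V) = ⊤) :
    (wedgeSymmetric.{u} V).FullSubcategory :=
  ofUltrametric one_eq_top (T := ULift.{u} Prop) (fun _ _ => ⊤)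
    ⟨fun _ => rfl, fun _ _ => rfl, fun _ _ _ => le_top⟩

/-- The morphism into the indiscrete `V`-category which classifies a subset. -/
def classify [IsQuantale V] (one_eq_top : (1 : V) = ⊤) (X : VCat.{u} V)
    (p : X.carrier → Prop) : X ⟶ (indiscrete.{u} one_eq_top).obj :=
  mkHom (fun x => ULift.up (p x)) fun _ _ => le_top

theorem exists_app_eq_of_jointlyMono₂_op [IsQuantale V] (one_eq_top : (1 : V) = ⊤)
    {R X Z : (wedgeSymmetric.{u} V).FullSubcategoryᵒᵖ} (r₁ : R ⟶ X) (r₂ : R ⟶ Z)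
    (hr : JointlyMono₂ r₁ r₂) (r : R.unop.obj.carrier) :
    (∃ x, app r₁.unop.hom x = r) ∨ ∃ z, app r₂.unop.hom z = r := by
  let p (r : R.unop.obj.carrier) : Prop :=
    (∃ x, app r₁.unop.hom x = r) ∨ ∃ z, app r₂.unop.hom z = r
  let f : R.unop ⟶ indiscrete.{u} one_eq_top :=
    ObjectProperty.homMk (classify one_eq_top R.unop.obj p)
  let g : R.unop ⟶ indiscrete.{u} one_eq_top :=
    ObjectProperty.homMk (classify one_eq_top R.unop.obj fun _ => True)
  have hfg : f.op = g.op := by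
    apply hr.right_cancellation
    · apply Quiver.Hom.unop_inj
      ext1
      apply hom_ext_app
      intro x
      exact congrArg ULift.up (eq_true (Or.inl ⟨x, rfl⟩ : p (app r₁.unop.hom x)))
    · apply Quiver.Hom.unop_inj
      ext1
      apply hom_ext_app
      intro x
      exact congrArg ULift.up (eq_true (Or.inr ⟨x, rfl⟩ : p (app r₂.unop.hom x)))
  have h : app f.hom r = app g.hom r := by rw [Quiver.Hom.op_inj hfg]
  exact of_eq_true (ULift.up_injective h)

/-- The extension of a pair of maps along a jointly surjective pair has to be shown to be a
`V`-functor only across the two images, where symmetry and transitivity for the meet chain the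
three given extensions. -/
theorem isMaltsevCategory_wedgeSymmetric_op [IsQuantale V] (one_eq_top : (1 : V) = ⊤) :
    IsMaltsevCategory (wedgeSymmetric.{u} V).FullSubcategoryᵒᵖ where
  hasFiniteLimits := by
    have : HasFiniteColimits (wedgeSymmetric.{u} V).FullSubcategory :=
      ⟨fun J _ _ => hasColimitsOfShape_wedgeSymmetric.{u} one_eq_top J⟩
    infer_instance
  isDifunctional {R X Z} r₁ r₂ hr Y x₁ x₂ z₁ z₂ := by
    rintro ⟨a, ha₁, ha₂⟩ ⟨b, hb₁, hb₂⟩ ⟨c, hc₁, hc₂⟩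
    have hcover := exists_app_eq_of_jointlyMono₂_op one_eq_top r₁ r₂ hr
    have key : ∀ {W : (wedgeSymmetric.{u} V).FullSubcategoryᵒᵖ} {r : R ⟶ W} {t : Y ⟶ R}
        {w : Y ⟶ W}, t ≫ r = w → ∀ x, app t.unop.hom (app r.unop.hom x) = app w.unop.hom x := by
      rintro _ _ _ _ rfl _
      rfl
    have ha₁ := key ha₁
    have ha₂ := key ha₂
    have hb₁ := key hb₁
    have hb₂ := key hb₂
    have hc₁ := key hc₁
    have hc₂ := key hc₂
    clear key
    -- the values prescribed on the two images agree where the images meet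
    have hd : ∀ r, ∃ y, (∀ x, app r₁.unop.hom x = r → y = app x₁.unop.hom x) ∧
        ∀ z, app r₂.unop.hom z = r → y = app z₁.unop.hom z := by
      have hglue : ∀ x z, app r₁.unop.hom x = app r₂.unop.hom z →
          app x₁.unop.hom x = app z₁.unop.hom z := fun x z h => by
        rw [← ha₁, h, ha₂, ← hb₂, ← h, hb₁, ← hc₁, h, hc₂]
      intro r
      rcases hcover r with ⟨x, rfl⟩ | ⟨z, rfl⟩
      · exact ⟨app x₁.unop.hom x, fun x' h => by rw [← ha₁, ← h, ha₁], fun z h => hglue x z h.symm⟩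
      · exact ⟨app z₁.unop.hom z, fun x h => (hglue x z h).symm, fun z' h => by rw [← hc₂, ← h, hc₂]⟩
    choose d hd₁ hd₂ using hd
    have hd₁ := fun x => hd₁ _ x rfl
    have hd₂ := fun z => hd₂ _ z rfl
    have hcross : ∀ x z, R.unop.obj.hom (app r₁.unop.hom x) (app r₂.unop.hom z) ≤
        Y.unop.obj.hom (app x₁.unop.hom x) (app z₁.unop.hom z) := by
      intro x z
      have h₁ := hom_le_hom_app a.unop.hom (app r₁.unop.hom x) (app r₂.unop.hom z)
      have h₂ := hom_le_hom_app b.unop.hom (app r₁.unop.hom x) (app r₂.unop.hom z)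
      have h₃ := hom_le_hom_app c.unop.hom (app r₁.unop.hom x) (app r₂.unop.hom z)
      rw [ha₁, ha₂] at h₁
      rw [hb₁, hb₂, Y.unop.property.2] at h₂
      rw [hc₁, hc₂] at h₃
      exact (le_inf ((le_inf h₁ h₂).trans (Y.unop.property.1 _ _ _)) h₃).trans
        (Y.unop.property.1 _ _ _)
    let t : R.unop ⟶ Y.unop := ObjectProperty.homMk (mkHom d fun r s => by
      rcases hcover r with ⟨x, rfl⟩ | ⟨z, rfl⟩ <;> rcases hcover s with ⟨x', rfl⟩ | ⟨z', rfl⟩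
      · rw [hd₁, hd₁, ← ha₁, ← ha₁]
        exact hom_le_hom_app _ _ _
      · rw [hd₁, hd₂]
        exact hcross x z'
      · rw [hd₁, hd₂, R.unop.property.2, Y.unop.property.2]
        exact hcross x' z
      · rw [hd₂, hd₂, ← hc₂, ← hc₂]
        exact hom_le_hom_app _ _ _)
    refine ⟨t.op, ?_, ?_⟩
    · apply Quiver.Hom.unop_inj
      ext1
      exact hom_ext_app hd₁
    · apply Quiver.Hom.unop_inj
      ext1
      exact hom_ext_app hd₂

/-! ### Limits and embeddings of `V`-categories -/

/-- The initial structure on a set, for a family of maps into `V`-categories. -/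
def initialLift [IsQuantale V] {T : Type u} {ι : Type*} (X : ι → VCat.{u} V)
    (f : ∀ i, T → (X i).carrier) : VCat.{u} V where
  carrier := T
  hom x y := ⨅ i, (X i).hom (f i x) (f i y)
  one_le_hom _ := le_iInf fun i => (X i).one_le_hom _
  hom_mul_hom_le _ _ _ := le_iInf fun i =>
    (mul_le_mul' (iInf_le _ i) (iInf_le _ i)).trans ((X i).hom_mul_hom_le _ _ _)

theorem wedgeSymmetric_initialLift [IsQuantale V] (one_eq_top : (1 : V) = ⊤) {T : Type u}
    {ι : Type*} (X : ι → VCat.{u} V) (f : ∀ i, T → (X i).carrier)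
    (hX : ∀ i, wedgeSymmetric V (X i)) : wedgeSymmetric V (initialLift X f) :=
  have h : IsUltrametric (initialLift X f).hom :=
    IsUltrametric.iInf fun i => (isUltrametric_hom one_eq_top ⟨X i, hX i⟩).comp (f i)
  ⟨h.trans, h.symm⟩

/-- A limit of `V`-categories, here a colimit in the opposite category, carries the initial
structure for its projections, and those to vertices `k` through which all others factor suffice.
It belongs to `V_∧-Cat_sym` as soon as these vertices do. -/
theorem wedgeSymmetric_of_isColimit_op [IsQuantale V] (one_eq_top : (1 : V) = ⊤) {J : Type*}
    [Category* J] {F : J ⥤ (VCat.{u} V)ᵒᵖ} {c : Cocone F} (hc : IsColimit c)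
    (hF : ∀ j, ∃ k, wedgeSymmetric V (F.obj k).unop ∧ Nonempty (j ⟶ k)) :
    wedgeSymmetric V c.pt.unop := by
  let I := {k // wedgeSymmetric V (F.obj k).unop}
  let π (j : J) : c.pt.unop ⟶ (F.obj j).unop := (c.ι.app j).unop
  let S : VCat.{u} V := initialLift (fun k : I => (F.obj k.1).unop) fun k => app (π k.1)
  have hS : ∀ j x y, S.hom x y ≤ (F.obj j).unop.hom (app (π j) x) (app (π j) y) := by
    intro j x y
    obtain ⟨k, hk, ⟨f⟩⟩ := hF j
    have hf : π k ≫ (F.map f).unop = π j := congrArg Quiver.Hom.unop (c.w f)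
    rw [← hf]
    exact (iInf_le _ (⟨k, hk⟩ : I)).trans (hom_le_hom_app (F.map f).unop _ _)
  let s : Cocone F :=
    { pt := Opposite.op S
      ι :=
        { app j := (mkHom (fun x => app (π j) x) (hS j) : S ⟶ (F.obj j).unop).op
          naturality i j f := by
            apply Quiver.Hom.unop_inj
            apply hom_ext_app
            intro x
            have h := app_unop_congr (c.w f) x
            exact h } }
  let l : S ⟶ c.pt.unop := (hc.desc s).unop
  let e : c.pt.unop ⟶ S := mkHom (fun x => x) fun x y => le_iInf fun i => hom_le_hom_app (π i.1) x y
  have hl : hc.desc s ≫ e.op = 𝟙 c.pt := by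
    apply hc.hom_ext
    intro j
    rw [← Category.assoc, hc.fac, Category.comp_id]
    rfl
  have hl' : ∀ x, app l x = x := app_unop_congr hl
  have hhom : c.pt.unop.hom = S.hom := by
    funext x y
    refine le_antisymm (hom_le_hom_app e x y) ?_
    have := hom_le_hom_app l x y
    rwa [hl' x, hl' y] at this
  have h := wedgeSymmetric_initialLift one_eq_top (fun k : I => (F.obj k.1).unop)
    (fun k => app (π k.1)) fun k => k.2
  rw [wedgeSymmetric, wedge, symmetric, hhom]
  exact h

/-- The cartesian product of two `V`-categories. -/
def prod [IsQuantale V] (X Y : VCat.{u} V) : VCat.{u} V where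
  carrier := X.carrier × Y.carrier
  hom p q := X.hom p.1 q.1 ⊓ Y.hom p.2 q.2
  one_le_hom _ := le_inf (X.one_le_hom _) (Y.one_le_hom _)
  hom_mul_hom_le _ _ _ := le_inf
    ((mul_le_mul' inf_le_left inf_le_left).trans (X.hom_mul_hom_le _ _ _))
    ((mul_le_mul' inf_le_right inf_le_right).trans (Y.hom_mul_hom_le _ _ _))

theorem prop_op_prod [IsQuantale V] {P : ObjectProperty (VCat.{u} V)ᵒᵖ}
    (hP : P.IsClosedUnderColimitsOfShape (Discrete WalkingPair)) {X Y : VCat.{u} V}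
    (hX : P (Opposite.op X)) (hY : P (Opposite.op Y)) : P (Opposite.op (prod X Y)) := by
  let p₁ : prod X Y ⟶ X := mkHom Prod.fst fun _ _ => inf_le_left
  let p₂ : prod X Y ⟶ Y := mkHom Prod.snd fun _ _ => inf_le_right
  have h : IsColimit (BinaryCofan.mk p₁.op p₂.op) :=
    BinaryCofan.isColimitMk
      (fun s => (mkHom (fun z => (app s.inl.unop z, app s.inr.unop z)) fun z w =>
        le_inf (hom_le_hom_app s.inl.unop z w) (hom_le_hom_app s.inr.unop z w) :
          s.pt.unop ⟶ prod X Y).op)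
      (fun s => rfl) (fun s => rfl)
      fun s m h₁ h₂ => by
        apply Quiver.Hom.unop_inj
        apply hom_ext_app
        intro z
        exact Prod.ext (app_unop_congr h₁ z) (app_unop_congr h₂ z)
  refine P.prop_of_isColimit h ?_
  rintro ⟨_ | _⟩
  exacts [hX, hY]

/-- An embedding of `V`-categories is an equalizer of two maps into an indiscrete `V`-category:
the one which classifies the image, and a constant one. -/
theorem isRegularEpi_op_of_embedding [IsQuantale V] (one_eq_top : (1 : V) = ⊤) {X Y : VCat.{u} V}
    (f : X ⟶ Y) (hf : Function.Injective (app f))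
    (hhom : ∀ x y, Y.hom (app f x) (app f y) ≤ X.hom x y) : IsRegularEpi f.op := by
  let p (y : Y.carrier) : Prop := ∃ x, app f x = y
  have w : (classify one_eq_top Y p).op ≫ f.op =
      (classify one_eq_top Y fun _ => True).op ≫
      f.op := by
    apply Quiver.Hom.unop_inj
    apply hom_ext_app
    intro x
    exact congrArg ULift.up (eq_true (⟨x, rfl⟩ : p (app f x)))
  refine ⟨⟨⟨_, _, _, w, Cofork.IsColimit.mk' _ fun s => ?_⟩⟩⟩
  have hs : ∀ z, p (app s.π.unop z) := fun z =>
    of_eq_true (ULift.up_injective (app_unop_congr s.condition z))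
  choose d hd using hs
  let l : s.pt.unop ⟶ X := mkHom d fun z w =>
    (hom_le_hom_app s.π.unop z w).trans (by rw [← hd, ← hd]; exact hhom _ _)
  refine ⟨l.op, ?_, fun {m} hm => ?_⟩
  · apply Quiver.Hom.unop_inj
    exact hom_ext_app hd
  · apply Quiver.Hom.unop_inj
    apply hom_ext_app
    intro z
    apply hf
    exact (app_unop_congr hm z).trans (hd z).symm

/-! ### Maximality -/

/-- The `V`-category with two points `false` and `true`, at distance `α` from `false` to `true` and
`β` from `true` to `false`. -/
def twoPoint [IsQuantale V] (one_eq_top : (1 : V) = ⊤) (α β : V) : VCat.{u} V where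
  carrier := ULift.{u} Bool
  hom x y :=
    match x.down, y.down with
    | false, true => α
    | true, false => β
    | false, false => ⊤
    | true, true => ⊤
  one_le_hom := by rintro ⟨_ | _⟩ <;> exact le_top
  hom_mul_hom_le := by
    rintro ⟨_ | _⟩ ⟨_ | _⟩ ⟨_ | _⟩ <;>
      first
        | exact le_top
        | exact (mul_le_inf one_eq_top _ _).trans inf_le_left
        | exact (mul_le_inf one_eq_top _ _).trans inf_le_right

/-- The morphism from a two-point `V`-category with given values. -/
def ofTwoPoint [IsQuantale V] (one_eq_top : (1 : V) = ⊤) {α β : V} {X : VCat.{u} V}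
    (x y : X.carrier) (hα : α ≤ X.hom x y) (hβ : β ≤ X.hom y x) :
    twoPoint.{u} one_eq_top α β ⟶ X :=
  mkHom (fun b => match b.down with
      | false => x
      | true => y) (by
    rintro ⟨_ | _⟩ ⟨_ | _⟩
    exacts [(hom_self one_eq_top X x).ge, hα, hβ, (hom_self one_eq_top X y).ge])

/-- The terminal `V`-category. -/
def point (V : Type v) [Monoid V] [CompleteLattice V] : VCat.{u} V where
  carrier := PUnit
  hom _ _ := ⊤
  one_le_hom _ := le_top
  hom_mul_hom_le _ _ _ := le_top

/-- A point of a `V`-category as a morphism. -/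
def ofPoint (one_eq_top : (1 : V) = ⊤) {X : VCat.{u} V} (x : X.carrier) : point.{u} V ⟶ X :=
  mkHom (fun _ => x) fun _ _ => (hom_self one_eq_top X x).ge

variable {P : ObjectProperty (VCat.{u} V)ᵒᵖ}

theorem prop_op_twoPoint [IsQuantale V] (one_eq_top : (1 : V) = ⊤) (hP : IsClosedUnderRegularEpi P)
    {X : VCat.{u} V} (hX : P (Opposite.op X)) {x y : X.carrier} (hxy : x ≠ y) :
    P (Opposite.op (twoPoint one_eq_top (X.hom x y) (X.hom y x))) := by
  refine hP _ (isRegularEpi_op_of_embedding one_eq_top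
    (ofTwoPoint one_eq_top x y le_rfl le_rfl) ?_ ?_) hX
  · rintro ⟨_ | _⟩ ⟨_ | _⟩ h
    exacts [rfl, (hxy h).elim, (hxy h.symm).elim, rfl]
  · rintro ⟨_ | _⟩ ⟨_ | _⟩
    exacts [le_top, le_rfl, le_rfl, le_top]

theorem prop_op_point [IsQuantale V] (one_eq_top : (1 : V) = ⊤) (hP : IsClosedUnderRegularEpi P)
    {X : VCat.{u} V} (hX : P (Opposite.op X)) (x : X.carrier) : P (Opposite.op (point V)) :=
  hP _ (isRegularEpi_op_of_embedding one_eq_top (ofPoint one_eq_top x)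
    (fun _ _ _ => rfl) fun _ _ => le_top) hX

/-- Difunctionality of the cospan of the two points of a two-point `V`-category: if the pairs
`(x, w)`, `(z, w)` and `(z, y)` of points of `X` all extend to it, then so does `(x, y)`. -/
theorem le_hom_of_isMaltsevCategory [IsQuantale V] (one_eq_top : (1 : V) = ⊤)
    (hP : IsMaltsevCategory P.FullSubcategory) {α β : V}
    (h₂ : P (Opposite.op (twoPoint one_eq_top α β))) (h₁ : P (Opposite.op (point V)))
    {X : VCat.{u} V} (hX : P (Opposite.op X)) {x y z w : X.carrier}
    (hxw : α ≤ X.hom x w) (hwx : β ≤ X.hom w x) (hzw : α ≤ X.hom z w) (hwz : β ≤ X.hom w z)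
    (hzy : α ≤ X.hom z y) (hyz : β ≤ X.hom y z) : α ≤ X.hom x y := by
  let R : P.FullSubcategory := ⟨_, h₂⟩
  let A : P.FullSubcategory := ⟨_, h₁⟩
  let Y : P.FullSubcategory := ⟨_, hX⟩
  let r (b : Bool) : R ⟶ A :=
    ObjectProperty.homMk (ofPoint one_eq_top (X := twoPoint one_eq_top α β) ⟨b⟩).op
  have hr : JointlyMono₂ (r false) (r true) := by
    refine ⟨fun B f g hf hg => ?_⟩
    ext1
    apply Quiver.Hom.unop_inj
    apply hom_ext_app
    rintro ⟨_ | _⟩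
    · exact app_unop_congr (congrArg (fun g => g.hom) hf) PUnit.unit
    · exact app_unop_congr (congrArg (fun g => g.hom) hg) PUnit.unit
  let pt (x : X.carrier) : Y ⟶ A := ObjectProperty.homMk (ofPoint one_eq_top x).op
  have hmem : ∀ {x y : X.carrier}, α ≤ X.hom x y → β ≤ X.hom y x →
      GenMem (pt x) (pt y) (r false) (r true) := fun hα hβ =>
    ⟨ObjectProperty.homMk (ofTwoPoint one_eq_top _ _ hα hβ).op, rfl, rfl⟩
  obtain ⟨t, ht₁, ht₂⟩ := hP.isDifunctional _ _ hr Y (pt x) (pt z) (pt y) (pt w)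
    (hmem hxw hwx) (hmem hzw hwz) (hmem hzy hyz)
  have hx : app t.hom.unop ⟨false⟩ = x := app_unop_congr (congrArg (fun g => g.hom) ht₁) PUnit.unit
  have hy : app t.hom.unop ⟨true⟩ = y := app_unop_congr (congrArg (fun g => g.hom) ht₂) PUnit.unit
  have h := hom_le_hom_app t.hom.unop ⟨false⟩ ⟨true⟩
  rw [hx, hy] at h
  exact h

theorem le_op_wedgeSymmetric [IsQuantale V] (one_eq_top : (1 : V) = ⊤)
    (hP : IsClosedMaltsevSubcategory P) : P ≤ (wedgeSymmetric.{u} V).op := by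
  intro Z hZ
  obtain ⟨X, rfl⟩ : ∃ X, Opposite.op X = Z := ⟨Z.unop, rfl⟩
  have hpt := prop_op_point one_eq_top hP.closedUnderRegularEpi hZ
  have hself : ∀ (a : V) (x : X.carrier), a ≤ X.hom x x := fun a x => by
    rw [hom_self one_eq_top]
    exact le_top
  refine ⟨fun x y z => ?_, ?_⟩
  · by_cases h : (x, y) = (y, z)
    · obtain ⟨rfl, rfl⟩ := Prod.mk.inj h
      exact inf_le_left
    -- two points of the square whose distance is the meet in question
    · have h₂ := prop_op_twoPoint one_eq_top hP.closedUnderRegularEpi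
        (prop_op_prod hP.closedUnderBinaryCoproducts hZ hZ) (x := (x, y)) (y := (y, z)) h
      exact le_hom_of_isMaltsevCategory one_eq_top hP.isMaltsevCategory h₂ (hpt x) hZ
        (x := x) (y := z) (z := y) (w := y)
        inf_le_left inf_le_left (hself _ _) (hself _ _) inf_le_right inf_le_right
  · have hle : ∀ x y : X.carrier, X.hom x y ≤ X.hom y x := by
      intro x y
      by_cases h : x = y
      · rw [h]
      · exact le_hom_of_isMaltsevCategory one_eq_top hP.isMaltsevCategory
          (prop_op_twoPoint one_eq_top hP.closedUnderRegularEpi hZ h) (hpt x) hZ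
          (x := y) (y := x) (z := x) (w := y)
          (hself _ _) (hself _ _) le_rfl le_rfl (hself _ _) (hself _ _)
    exact fun x y => le_antisymm (hle x y) (hle y x)

theorem isClosedMaltsevSubcategory_wedgeSymmetric [IsQuantale V] (one_eq_top : (1 : V) = ⊤) :
    IsClosedMaltsevSubcategory (wedgeSymmetric.{u} V).op where
  isMaltsevCategory := (isMaltsevCategory_wedgeSymmetric_op one_eq_top).of_equivalence
    (wedgeSymmetric.{u} V).opEquivalence.symm
  closedUnderBinaryCoproducts := ⟨fun _ ⟨h⟩ =>
    wedgeSymmetric_of_isColimit_op one_eq_top h.isColimit fun j =>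
      ⟨j, h.prop_diag_obj j, ⟨𝟙 j⟩⟩⟩
  closedUnderRegularEpi := by
    rintro X Y f ⟨⟨h⟩⟩ hX
    refine wedgeSymmetric_of_isColimit_op one_eq_top h.isColimit fun j =>
      ⟨WalkingParallelPair.one, hX, ?_⟩
    cases j
    exacts [⟨WalkingParallelPairHom.left⟩, ⟨𝟙 _⟩]

theorem wedgeSymmetric_eq_symmetric (h : IsCartesian V) :
    wedgeSymmetric.{u} V = symmetric.{u} V := by
  ext X
  exact ⟨fun hX => hX.2, fun hX => ⟨fun x y z => h _ _ ▸ X.hom_mul_hom_le x y z, hX⟩⟩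

end VCat

end MaltsevDual

theorem mainTheorem5 {V : Type v} [Monoid V] [CompleteLattice V] [IsQuantale V]
    (one_eq_top : (1 : V) = ⊤) (top_ne_bot : (⊤ : V) ≠ ⊥) :
    (MaltsevDual.IsCartesian V →
      MaltsevDual.IsMaltsevCategory (MaltsevDual.VCat.symmetric.{u} V).FullSubcategoryᵒᵖ) ∧
    IsGreatest
      {P : ObjectProperty (MaltsevDual.VCat.{u} V)ᵒᵖ | MaltsevDual.IsClosedMaltsevSubcategory P}
      (MaltsevDual.VCat.wedgeSymmetric.{u} V).op := by
  refine ⟨fun h => ?_, MaltsevDual.VCat.isClosedMaltsevSubcategory_wedgeSymmetric one_eq_top,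
    fun P hP => MaltsevDual.VCat.le_op_wedgeSymmetric one_eq_top hP⟩
  rw [← MaltsevDual.VCat.wedgeSymmetric_eq_symmetric h]
  exact MaltsevDual.VCat.isMaltsevCategory_wedgeSymmetric_op one_eq_top
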